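/- Let $n\ge 3$, let $\vec A_n$ be the linearly oriented quiver $1\to 2\to\cdots\to n$, and let $K$ be a field. Let $R$ be a set of zero relations on $\vec A_n$, that is, a set of paths of length at least $2$, and let $A=K\vec A_n/\langle R\rangle$ be the corresponding bound quiver algebra, where left modules are taken with respect to the convention that $P(a)=Ae_a$ is spanned by the residue classes of the paths with source $a$. Write $R_0^s$ for the set of sources and $R_0^t$ for the set of targets of the relations in $R$, and, for a vertex $a<n$, write $a^+=a+1$ for its immediate successor. A vertex is called free if it lies neither in $R_0^s$ nor in $R_0^t$. For an $A$-module $M$ and $m\ge 0$ write $\operatorname{dom.dim} M\ge m$ if $M$ has a minimal injective resolution $0\to M\to I_1\to I_2\to\cdots$ in which $I_1,\dots,I_m$ are projective; $\operatorname{dom.dim} M\in\mathbb N\cup\{\infty\}$ is the largest such $m$ ($\infty$ if there is no largest one), and $\operatorname{dom.dim}A$ is the dominant dimension of the left regular module ${}_AA$. (i) If there is a vertex $a<n$ with $a\notin R_0^s$ and $a^+\notin R_0^t$, then $\operatorname{dom.dim}A=1$. (ii) If there is a free vertex, then $\operatorname{dom.dim}A\le 2$. -/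

import Mathlib

universe u v w

/-! ### Path algebras and bound quiver algebras -/

/-- A path in a quiver, bundled with its source and its target
(trivial paths, of length `0`, are included). -/
structure QuiverPath (V : Type v) [Quiver.{w} V] where
  /-- the source of the path -/
  source : V
  /-- the target of the path -/
  target : V
  /-- the path itself -/
  path : Quiver.Path source target

namespace QuiverPath

variable {V : Type v} [Quiver.{w} V]

/-- The number of arrows in a path. -/
def length (p : QuiverPath V) : ℕ := p.path.length

/-- The trivial path at a vertex. -/
def nil (a : V) : QuiverPath V := ⟨a, a, Quiver.Path.nil⟩

/-- `p.after q h` is the path that runs first through `q` and then through `p`. -/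
def after (p q : QuiverPath V) (h : q.target = p.source) : QuiverPath V :=
  ⟨q.source, p.target, q.path.comp (p.path.cast h.symm rfl)⟩

theorem after_nil (p : QuiverPath V) : p.after (nil p.source) rfl = p := by
  cases p
  simp [after, nil]

theorem nil_after (p : QuiverPath V) : (nil p.target).after p rfl = p := by
  cases p
  simp [after, nil]

theorem after_assoc (p q r : QuiverPath V) (h : q.target = p.source) (h' : r.target = q.source) :
    (p.after q h).after r h' = p.after (q.after r h') h := by
  obtain ⟨a, b, p⟩ := p
  obtain ⟨c, d, q⟩ := q
  obtain ⟨e, f, r⟩ := r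
  dsimp only at h h'
  subst h h'
  simp [after]

end QuiverPath

/-- The path algebra `K V` of a quiver with vertex set `V`: the `K`-vector space on the set of all
paths. -/
def PathAlgebra (K : Type u) (V : Type v) [Field K] [Quiver.{w} V] : Type (max u v w) :=
  QuiverPath V →₀ K

namespace PathAlgebra

noncomputable section

variable (K : Type u) {V : Type v} [Field K] [Quiver.{w} V]

instance : AddCommGroup (PathAlgebra K V) := inferInstanceAs (AddCommGroup (QuiverPath V →₀ K))

instance : Module K (PathAlgebra K V) := inferInstanceAs (Module K (QuiverPath V →₀ K))

/-- The basis element of the path algebra given by a path. -/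
def ofPath (p : QuiverPath V) : PathAlgebra K V := Finsupp.single p 1

open Classical in
/-- The product `p * q` of two paths: the path "first `q`, then `p`" if `q` ends where `p` starts,
and zero otherwise. With this convention the left module `A e_a` is spanned by the paths
with source `a`. -/
def pathMul (p q : QuiverPath V) : PathAlgebra K V :=
  if h : q.target = p.source then ofPath K (p.after q h) else 0

/-- The linear extension to the path algebra of a map that is defined on paths. -/
def lift {W : Type*} [AddCommGroup W] [Module K W] (f : QuiverPath V → W) :
    PathAlgebra K V →ₗ[K] W :=
  Finsupp.linearCombination K f

theorem lift_ofPath {W : Type*} [AddCommGroup W] [Module K W] (f : QuiverPath V → W)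
    (p : QuiverPath V) : lift K f (ofPath K p) = f p :=
  (Finsupp.linearCombination_single K 1 p).trans (one_smul K (f p))

/-- The bilinear extension of `pathMul`. -/
def mulHom : PathAlgebra K V →ₗ[K] PathAlgebra K V →ₗ[K] PathAlgebra K V :=
  lift K fun p => lift K fun q => pathMul K p q

instance : Mul (PathAlgebra K V) := ⟨fun x y => mulHom K x y⟩

theorem mul_def (x y : PathAlgebra K V) : x * y = mulHom K x y := rfl

theorem ofPath_mul_ofPath (p q : QuiverPath V) :
    ofPath K p * ofPath K q = pathMul K p q := by
  rw [mul_def, mulHom, lift_ofPath, lift_ofPath]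

/-- The path algebra is spanned by the paths. -/
theorem induction_on {P : PathAlgebra K V → Prop} (x : PathAlgebra K V) (zero : P 0)
    (add : ∀ x y, P x → P y → P (x + y)) (smul : ∀ (c : K) (p), P (c • ofPath K p)) : P x := by
  refine Finsupp.induction_linear x zero (fun f g hf hg => add f g hf hg) fun p c => ?_
  have h : (Finsupp.single p c : QuiverPath V →₀ K) = c • Finsupp.single p 1 := by simp
  rw [h]
  exact smul c p

theorem pathMul_assoc (p q r : QuiverPath V) :
    pathMul K p q * ofPath K r = ofPath K p * pathMul K q r := by
  have h0 (x : PathAlgebra K V) : 0 * x = 0 := by simp [mul_def]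
  have h0' (x : PathAlgebra K V) : x * 0 = 0 := by simp [mul_def]
  by_cases h : q.target = p.source
  · by_cases h' : r.target = q.source
    · have e1 : pathMul K p q = ofPath K (p.after q h) := dif_pos h
      have e2 : pathMul K q r = ofPath K (q.after r h') := dif_pos h'
      have e3 : pathMul K (p.after q h) r = ofPath K ((p.after q h).after r h') := dif_pos h'
      have e4 : pathMul K p (q.after r h') = ofPath K (p.after (q.after r h') h) := dif_pos h
      rw [e1, e2, ofPath_mul_ofPath, ofPath_mul_ofPath, e3, e4, QuiverPath.after_assoc]
    · have e1 : pathMul K p q = ofPath K (p.after q h) := dif_pos h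
      have e2 : pathMul K q r = 0 := dif_neg h'
      have e3 : pathMul K (p.after q h) r = 0 := dif_neg h'
      rw [e1, e2, ofPath_mul_ofPath, e3, h0']
  · have e1 : pathMul K p q = 0 := dif_neg h
    rw [e1, h0]
    by_cases h' : r.target = q.source
    · have e2 : pathMul K q r = ofPath K (q.after r h') := dif_pos h'
      have e4 : pathMul K p (q.after r h') = 0 := dif_neg h
      rw [e2, ofPath_mul_ofPath, e4]
    · have e2 : pathMul K q r = 0 := dif_neg h'
      rw [e2, h0']

theorem mul_assoc' (x y z : PathAlgebra K V) : x * y * z = x * (y * z) := by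
  induction x using induction_on with
  | zero => simp [mul_def]
  | add x x' hx hx' => simp_all [mul_def]
  | smul a p =>
    induction y using induction_on with
    | zero => simp [mul_def]
    | add y y' hy hy' => simp_all [mul_def]
    | smul b q =>
      induction z using induction_on with
      | zero => simp [mul_def]
      | add z z' hz hz' =>
        simp only [mul_def, map_add] at hz hz' ⊢
        rw [hz, hz']
      | smul c r =>
        have h := pathMul_assoc K p q r
        rw [← ofPath_mul_ofPath, ← ofPath_mul_ofPath] at h
        simp only [mul_def, map_smul, LinearMap.smul_apply] at h ⊢
        rw [h]

variable [Fintype V]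

/-- The identity of the path algebra of a quiver with finitely many vertices: the sum of all
trivial paths. -/
instance : One (PathAlgebra K V) := ⟨∑ a : V, ofPath K (QuiverPath.nil a)⟩

theorem one_def : (1 : PathAlgebra K V) = ∑ a : V, ofPath K (QuiverPath.nil a) := rfl

theorem one_mul' (x : PathAlgebra K V) : 1 * x = x := by
  induction x using induction_on with
  | zero => simp [mul_def]
  | add x x' hx hx' => simp_all [mul_def]
  | smul a p =>
    have key : (1 : PathAlgebra K V) * ofPath K p = ofPath K p := by
      rw [mul_def, one_def, map_sum, LinearMap.sum_apply, Finset.sum_eq_single p.target]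
      · rw [← mul_def, ofPath_mul_ofPath]
        exact (dif_pos rfl).trans (congrArg _ p.nil_after)
      · intro b _ hb
        rw [← mul_def, ofPath_mul_ofPath]
        exact dif_neg fun h => hb h.symm
      · simp
    rw [mul_def] at key ⊢
    rw [map_smul, key]

theorem mul_one' (x : PathAlgebra K V) : x * 1 = x := by
  induction x using induction_on with
  | zero => simp [mul_def]
  | add x x' hx hx' => simp_all [mul_def]
  | smul a p =>
    have key : ofPath K p * (1 : PathAlgebra K V) = ofPath K p := by
      rw [mul_def, one_def, map_sum, Finset.sum_eq_single p.source]
      · rw [← mul_def, ofPath_mul_ofPath]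
        exact (dif_pos rfl).trans (congrArg _ p.after_nil)
      · intro b _ hb
        rw [← mul_def, ofPath_mul_ofPath]
        exact dif_neg fun h => hb h
      · simp
    rw [mul_def] at key ⊢
    rw [map_smul, LinearMap.smul_apply, key]

instance : Ring (PathAlgebra K V) where
  __ := (inferInstance : AddCommGroup (PathAlgebra K V))
  mul_assoc := mul_assoc' K
  one_mul := one_mul' K
  mul_one := mul_one' K
  left_distrib x y z := by simp [mul_def]
  right_distrib x y z := by simp [mul_def]
  zero_mul x := by simp [mul_def]
  mul_zero x := by simp [mul_def]

instance : Algebra K (PathAlgebra K V) :=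
  Algebra.ofModule (fun c x y => by simp [mul_def]) (fun c x y => by simp [mul_def])

end

end PathAlgebra

/-- A zero (monomial) relation in a quiver: a path of length at least two. -/
def IsZeroRelation {V : Type v} [Quiver.{w} V] (p : QuiverPath V) : Prop := 2 ≤ p.length

/-- The two-sided ideal of the path algebra generated by a set of paths. -/
noncomputable def relationIdeal (K : Type u) {V : Type v} [Field K] [Quiver.{w} V] [Fintype V]
    (R : Set (QuiverPath V)) : TwoSidedIdeal (PathAlgebra K V) :=
  TwoSidedIdeal.span (PathAlgebra.ofPath K '' R)

/-- The algebra `K V / ⟨R⟩` of a quiver bound by a set `R` of paths. -/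
abbrev BoundQuiverAlgebra (K : Type u) {V : Type v} [Field K] [Quiver.{w} V] [Fintype V]
    (R : Set (QuiverPath V)) : Type (max u v w) :=
  (relationIdeal K R).ringCon.Quotient

/-- The set of sources of the relations in `R`. -/
def relationSources {V : Type v} [Quiver.{w} V] (R : Set (QuiverPath V)) : Set V :=
  QuiverPath.source '' R

/-- The set of targets of the relations in `R`. -/
def relationTargets {V : Type v} [Quiver.{w} V] (R : Set (QuiverPath V)) : Set V :=
  QuiverPath.target '' R

/-- A vertex is free if it is neither the source nor the target of any relation in `R`. -/
def IsFreeVertex {V : Type v} [Quiver.{w} V] (R : Set (QuiverPath V)) (a : V) : Prop :=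
  a ∉ relationSources R ∧ a ∉ relationTargets R

/-! ### The linearly oriented quiver -/

/-- The vertices of the linearly oriented quiver `1 → 2 → ⋯ → n`;
the vertex `i` is represented by the element `i - 1` of `Fin n`. -/
def LinearQuiver (n : ℕ) : Type := Fin n

namespace LinearQuiver

instance (n : ℕ) : Fintype (LinearQuiver n) := inferInstanceAs (Fintype (Fin n))

instance (n : ℕ) : DecidableEq (LinearQuiver n) := inferInstanceAs (DecidableEq (Fin n))

/-- The position of a vertex, counted from `0`. -/
def pos {n : ℕ} (a : LinearQuiver n) : ℕ := Fin.val a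

/-- There is exactly one arrow from each vertex to the next one, and there are no other arrows. -/
instance (n : ℕ) : Quiver.{0} (LinearQuiver n) where
  Hom a b := PLift (pos a + 1 = pos b)

end LinearQuiver

/-! ### Minimal injective resolutions and dominant dimension -/

/-- A submodule is essential if it meets every nonzero submodule nontrivially. -/
def IsEssentialSubmodule {A : Type u} [Ring A] {M : Type v} [AddCommGroup M] [Module A M]
    (N : Submodule A M) : Prop :=
  ∀ L : Submodule A M, N ⊓ L = ⊥ → L = ⊥

/-- A minimal injective resolution `0 → M → I 0 → I 1 → I 2 → ⋯` of a left `A`-module `M`: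
an exact sequence with injective modules `I k`, such that `I 0` is an injective envelope of the
image of `M` and `I (k + 1)` is an injective envelope of the image of `I k`. -/
structure MinimalInjectiveResolution (A : Type u) [Ring A] (M : Type u) [AddCommGroup M]
    [Module A M] where
  /-- the terms of the resolution -/
  I : ℕ → ModuleCat.{u} A
  /-- the augmentation -/
  ι : M →ₗ[A] I 0
  /-- the differentials -/
  d : ∀ k, I k →ₗ[A] I (k + 1)
  injective : ∀ k, Module.Injective A (I k)
  ι_injective : Function.Injective ι
  exact_zero : Function.Exact ι (d 0)
  exact_succ : ∀ k, Function.Exact (d k) (d (k + 1))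
  essential_zero : IsEssentialSubmodule (LinearMap.range ι)
  essential_succ : ∀ k, IsEssentialSubmodule (LinearMap.range (d k))

/-- `dom.dim M ≥ m`: there is a minimal injective resolution of `M` whose first `m` terms are
projective (hence projective-injective). -/
def DomDimGE (A : Type u) [Ring A] (M : Type u) [AddCommGroup M] [Module A M] (m : ℕ) : Prop :=
  ∃ J : MinimalInjectiveResolution A M, ∀ k < m, Module.Projective A (J.I k)

/-- The dominant dimension of a left module: the largest `m` with `dom.dim M ≥ m`, and `∞` if
there is no largest one. -/
noncomputable def moduleDomDim (A : Type u) [Ring A] (M : Type u) [AddCommGroup M] [Module A M] :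
    ℕ∞ :=
  ⨆ (m : ℕ) (_ : DomDimGE A M m), (m : ℕ∞)

/-- The dominant dimension of a ring: that of its left regular module. -/
noncomputable def domDim (A : Type u) [Ring A] : ℕ∞ := moduleDomDim A A

/-! ### Injective envelopes and minimal injective resolutions -/

section InjectiveEnvelopes

variable {A : Type u} [Ring A]

/-! The residue classes of the paths containing no relation form a basis of A indexed by intervals
[i, j] (`intervalCoordinates`); the rest depends only on which intervals are nonzero.

Always dom.dim A ≥ 1: if [c, b] is a maximal nonzero interval, then P(c) is injective, and every
P(a) embeds into such a P(c) (`injective_proj`, `domDimGE_one`).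

For the upper bounds, regard a module M as a representation with spaces e_i M. Let u be the arrow a
→ a⁺. If a is no source of a relation, u maps e_a I onto e_{a⁺} I for every injective I. If a⁺ is no
target, u is injective on e_a P for every projective P. If the second term of the resolution were
projective, exactness would then make u map e_a A onto e_{a⁺} A, but e_{a⁺} is not in uA. This is
(i).

For (ii), let a be free with predecessor a', and let u be the arrow a' → a, which is injective on
projectives. If every nonzero path from a stays nonzero after u, the previous argument applies to u.
Otherwise let q be the shortest nonzero path from a with qu = 0. On injectives, the kernel of q on
e_a I is the image of u. Let r be the path from a⁺ to the end of q. Since a is no source, r becomes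
divisible by q in the first injective. This gives a class in ker q / im u on the first cosyzygy, and
then an element of ker u on the second. If the third term were projective this element would vanish,
and r would lie in qA, which is false. If a is the first vertex, a⁺ cannot be a target and (i)
applies. -/

theorem Submodule.exists_maximal_disjoint {E : Type v} [AddCommGroup E] [Module A E]
    {N M : Submodule A E} (h : Disjoint N M) :
    ∃ C, N ≤ C ∧ Disjoint C M ∧ ∀ C', C ≤ C' → Disjoint C' M → C' = C := by
  obtain ⟨C, hNC, hC⟩ := zorn_le_nonempty₀ {C : Submodule A E | Disjoint C M}
    (fun c hc hchain y hy => ⟨sSup c, Submodule.disjoint_def.2 fun x hx hxM => by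
      obtain ⟨z, hz, hxz⟩ := (Submodule.mem_sSup_of_directed ⟨y, hy⟩ hchain.directedOn).1 hx
      exact Submodule.disjoint_def.1 (hc hz) x hxz hxM, fun z hz => le_sSup hz⟩) N h
  exact ⟨C, hNC, hC.1, fun C' h1 h2 => le_antisymm (hC.2 h2 h1) h1⟩

/-- Inside an injective module, every submodule has an essential extension that is a direct
summand. -/
theorem Submodule.exists_essential_summand {E : Type v} [AddCommGroup E] [Module A E]
    [Small.{v} A] [Module.Injective A E] (M : Submodule A E) :
    ∃ H : Submodule A E, M ≤ H ∧ (∀ L ≤ H, Disjoint L M → L = ⊥) ∧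
      ∃ π : E →ₗ[A] H, ∀ x : H, π x = x := by
  obtain ⟨C, -, hCM, hCmax⟩ := Submodule.exists_maximal_disjoint (disjoint_bot_left (a := M))
  obtain ⟨H, hMH, hHC, hHmax⟩ := Submodule.exists_maximal_disjoint hCM.symm
  have hess : ∀ L ≤ H, Disjoint L M → L = ⊥ := by
    intro L hL hLM
    -- If c + l lies in M ≤ H, then c lies in H and in C, so c = 0; hence C ⊔ L is still disjoint
    -- from M.
    have h : C ⊔ L = C := by
      refine hCmax _ le_sup_left (Submodule.disjoint_def.2 fun x hx hxM => ?_)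
      obtain ⟨c, hc, l, hl, rfl⟩ := Submodule.mem_sup.1 hx
      have hc0 : c = 0 := by
        refine Submodule.disjoint_def.1 hHC c ?_ hc
        have := H.sub_mem (hMH hxM) (hL hl)
        simpa using this
      subst hc0
      rw [zero_add] at hxM ⊢
      exact Submodule.disjoint_def.1 hLM l hl hxM
    have hLC : L ≤ C := h ▸ le_sup_right
    exact disjoint_self.1 (hHC.mono hL hLC)
  have hinj : Function.Injective (C.mkQ ∘ₗ H.subtype) := by
    rw [← LinearMap.ker_eq_bot, LinearMap.ker_eq_bot']
    intro x hx
    have : (x : E) ∈ C := by simpa using hx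
    exact Subtype.ext (Submodule.disjoint_def.1 hHC _ x.2 this)
  -- H embeds into E ⧸ C, so its inclusion into E extends to E ⧸ C. The two maximality properties
  -- then force `g ∘ₗ C.mkQ` to have kernel C and image H.
  obtain ⟨g, hg⟩ := Module.Injective.out (C.mkQ ∘ₗ H.subtype) hinj H.subtype
  have hgx : ∀ x : H, g (C.mkQ x) = x := hg
  have hgker : LinearMap.ker (g ∘ₗ C.mkQ) = C := by
    refine hCmax _ (fun x hx => ?_) ?_
    · have : C.mkQ x = 0 := by simpa using hx
      simp [this]
    · refine Submodule.disjoint_def.2 fun x hx hxM => ?_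
      have := hgx ⟨x, hMH hxM⟩
      exact this.symm.trans hx
  have hle : H ≤ LinearMap.range (g ∘ₗ C.mkQ) := fun x hx => ⟨x, hgx ⟨x, hx⟩⟩
  have hrange : LinearMap.range (g ∘ₗ C.mkQ) = H := by
    refine hHmax _ hle (Submodule.disjoint_def.2 ?_)
    rintro _ ⟨y, rfl⟩ hyC
    -- the preimage of `C` under `g ∘ mkQ` meets `M` trivially
    have hD : Submodule.comap (g ∘ₗ C.mkQ) C = C := by
      refine hCmax _ (fun x hx => ?_) (Submodule.disjoint_def.2 fun x hx hxM => ?_)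
      · have : (g ∘ₗ C.mkQ) x = 0 := by
          rw [← LinearMap.mem_ker, hgker]; exact hx
        rw [Submodule.mem_comap, this]
        exact C.zero_mem
      · have h1 : (g ∘ₗ C.mkQ) x = x := hgx ⟨x, hMH hxM⟩
        rw [Submodule.mem_comap, h1] at hx
        exact Submodule.disjoint_def.1 hCM x hx hxM
    have : y ∈ LinearMap.ker (g ∘ₗ C.mkQ) := by
      rw [hgker, ← hD]
      exact hyC
    exact this
  refine ⟨H, hMH, hess, (g ∘ₗ C.mkQ).codRestrict H fun x => hrange ▸ ⟨x, rfl⟩, fun x => ?_⟩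
  exact Subtype.ext (hgx x)

/-- A module that embeds into an injective module `E` has an injective envelope that is a direct
summand of `E`. -/
theorem exists_injectiveEnvelope_of_injective {M E : Type u} [AddCommGroup M] [Module A M]
    [AddCommGroup E] [Module A E] [Module.Injective A E] (f : M →ₗ[A] E)
    (hf : Function.Injective f) :
    ∃ (H : ModuleCat.{u} A) (ι : M →ₗ[A] H), Function.Injective ι ∧ Module.Injective A H ∧
      IsEssentialSubmodule (LinearMap.range ι) ∧
      (Module.Projective A E → Module.Projective A H) := by
  obtain ⟨H, hMH, hess, π, hπ⟩ := Submodule.exists_essential_summand (LinearMap.range f)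
  have hfH : ∀ x, f x ∈ H := fun x => hMH ⟨x, rfl⟩
  refine ⟨ModuleCat.of A H, f.codRestrict H hfH, fun x y hxy => hf ?_, ⟨?_⟩, ?_, ?_⟩
  · exact congrArg Subtype.val hxy
  · intro X Y _ _ _ _ i hi g
    obtain ⟨h, hh⟩ := Module.Injective.out i hi (H.subtype ∘ₗ g)
    exact ⟨π ∘ₗ h, fun x => by
      rw [LinearMap.comp_apply, hh]
      exact hπ (g x)⟩
  · intro L hL
    have h := hess (L.map H.subtype) (Submodule.map_subtype_le H L)
      (Submodule.disjoint_def.2 ?_)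
    · exact Submodule.map_injective_of_injective H.subtype_injective (h.trans (Submodule.map_bot _).symm)
    · rintro _ ⟨x, hx, rfl⟩ ⟨m, hm⟩
      have : x ∈ LinearMap.range (f.codRestrict H hfH) ⊓ L := ⟨⟨m, Subtype.ext hm⟩, hx⟩
      rw [hL] at this
      rw [(Submodule.mem_bot A).1 this, map_zero]
  · intro hE
    exact Module.Projective.of_split H.subtype π (LinearMap.ext hπ)

theorem exists_injective_linearMap_to_injective (M : Type u) [AddCommGroup M] [Module A M] :
    ∃ (E : ModuleCat.{u} A) (f : M →ₗ[A] E), Module.Injective A E ∧ Function.Injective f := by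
  obtain ⟨I, hI, f, hf⟩ := CategoryTheory.EnoughInjectives.presentation (ModuleCat.of A M)
  exact ⟨I, f.hom, Module.injective_module_of_injective_object A I,
    (ModuleCat.mono_iff_injective f).1 hf⟩

/-- Every module has a minimal injective resolution, which starts with a projective module if the
module embeds into a projective-injective one. -/
theorem exists_minimalInjectiveResolution (M : Type u) [AddCommGroup M] [Module A M] :
    ∃ J : MinimalInjectiveResolution A M, ∀ (E : Type u) [AddCommGroup E] [Module A E]
      [Module.Injective A E] [Module.Projective A E] (f : M →ₗ[A] E),
      Function.Injective f → Module.Projective A (J.I 0) := by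
  have key : ∀ X : ModuleCat.{u} A, ∃ (H : ModuleCat.{u} A) (ι : X →ₗ[A] H),
      Function.Injective ι ∧ Module.Injective A H ∧ IsEssentialSubmodule (LinearMap.range ι) ∧
      ∀ (E : Type u) [AddCommGroup E] [Module A E] [Module.Injective A E] [Module.Projective A E]
        (f : X →ₗ[A] E), Function.Injective f → Module.Projective A H := by
    intro X
    -- The envelope of X has to be fixed before any E is given, so it is cut out of a
    -- projective-injective module whenever one contains X.
    by_cases h : ∃ (E : Type u) (_ : AddCommGroup E) (_ : Module A E) (_ : Module.Injective A E)
        (_ : Module.Projective A E) (f : X →ₗ[A] E), Function.Injective f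
    · obtain ⟨E, _, _, _, hP, f, hf⟩ := h
      obtain ⟨H, ι, h1, h2, h3, h4⟩ := exists_injectiveEnvelope_of_injective f hf
      exact ⟨H, ι, h1, h2, h3, fun _ _ _ _ _ _ _ => h4 hP⟩
    · obtain ⟨E, f, _, hf⟩ := exists_injective_linearMap_to_injective (A := A) X
      obtain ⟨H, ι, h1, h2, h3, -⟩ := exists_injectiveEnvelope_of_injective f hf
      exact ⟨H, ι, h1, h2, h3, fun E i1 i2 i3 i4 f hf => (h ⟨E, i1, i2, i3, i4, f, hf⟩).elim⟩
  choose H ι hι hinj hess hproj using key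
  let S : ModuleCat.{u} A → ModuleCat.{u} A := fun X => ModuleCat.of A (H X ⧸ LinearMap.range (ι X))
  let d : ∀ X, H X →ₗ[A] H (S X) := fun X => ι (S X) ∘ₗ (LinearMap.range (ι X)).mkQ
  have hd : ∀ X, LinearMap.range (d X) = LinearMap.range (ι (S X)) := fun X =>
    LinearMap.range_comp_of_range_eq_top _ (Submodule.range_mkQ _)
  have hd0 : ∀ X, Function.Exact (ι X) (d X) := fun X x =>
    (LinearMap.map_eq_zero_iff (ι (S X)) (hι _)).trans
      ((Submodule.Quotient.mk_eq_zero _).trans Iff.rfl)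
  have hd1 : ∀ X, Function.Exact (d X) (d (S X)) := fun X x =>
    (hd0 (S X) x).trans (by
      rw [← LinearMap.coe_range, ← hd X, LinearMap.coe_range])
  have hdess : ∀ X, IsEssentialSubmodule (LinearMap.range (d X)) := fun X => by
    rw [hd]
    exact hess _
  -- The iterated cosyzygies of M.
  let C : ℕ → ModuleCat.{u} A := fun k => Nat.rec (ModuleCat.of A M) (fun _ X => S X) k
  exact ⟨{
    I := fun k => H (C k)
    ι := ι (C 0)
    d := fun k => d (C k)
    injective := fun k => hinj _
    ι_injective := hι _
    exact_zero := hd0 (C 0)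
    exact_succ := fun k => hd1 (C k)
    essential_zero := hess _
    essential_succ := fun k => hdess (C k) },
    fun E _ _ _ _ f hf => hproj (C 0) E f hf⟩

theorem domDimGE_one_of_injective {M E : Type u} [AddCommGroup M] [Module A M]
    [AddCommGroup E] [Module A E] [Module.Injective A E] [Module.Projective A E]
    (f : M →ₗ[A] E) (hf : Function.Injective f) : DomDimGE A M 1 := by
  obtain ⟨J, hJ⟩ := exists_minimalInjectiveResolution (A := A) M
  refine ⟨J, fun k hk => ?_⟩
  obtain rfl : k = 0 := by omega
  exact hJ E f hf

theorem DomDimGE.mono {M : Type u} [AddCommGroup M] [Module A M] {m k : ℕ}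
    (h : DomDimGE A M m) (hk : k ≤ m) : DomDimGE A M k := by
  obtain ⟨J, hJ⟩ := h
  exact ⟨J, fun i hi => hJ i (by omega)⟩

theorem moduleDomDim_le_of_not {M : Type u} [AddCommGroup M] [Module A M] {m : ℕ}
    (h : ¬ DomDimGE A M (m + 1)) : moduleDomDim A M ≤ m := by
  refine iSup₂_le fun k hk => ?_
  by_contra hlt
  have : m < k := by exact_mod_cast not_le.1 hlt
  exact h (hk.mono this)

/-! ### Obstructions to a large dominant dimension -/

/-- An injective module is divisible by `r` as far as annihilators permit. -/
theorem Module.Injective.exists_smul_eq {I : Type u} [AddCommGroup I] [Module A I]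
    (hI : Module.Injective A I) (r : A) (z : I) (h : ∀ x : A, x * r = 0 → x • z = 0) :
    ∃ w : I, r • w = z := by
  -- The annihilator condition makes x r ↦ x z well defined on the left ideal A r, here presented as
  -- A ⧸ ker φ; an extension to A sends 1 to the required w.
  let φ := LinearMap.toSpanSingleton A A r
  have hle : LinearMap.ker φ ≤ LinearMap.ker (LinearMap.toSpanSingleton A I z) := fun x hx => h x hx
  obtain ⟨g, hg⟩ := Module.Injective.out ((LinearMap.ker φ).liftQ φ le_rfl)
    (LinearMap.ker_eq_bot.1 (Submodule.ker_liftQ_eq_bot' _ _ rfl))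
    ((LinearMap.ker φ).liftQ (LinearMap.toSpanSingleton A I z) hle)
  refine ⟨g 1, ?_⟩
  have := hg (Submodule.Quotient.mk 1)
  rw [Submodule.liftQ_apply, Submodule.liftQ_apply, LinearMap.toSpanSingleton_apply,
    LinearMap.toSpanSingleton_apply, one_smul, one_smul] at this
  rw [← map_smul, smul_eq_mul, mul_one, this]

/-- A projective module embeds into a free one, where the condition can be checked in each
coordinate. -/
theorem Module.Projective.eq_zero_of_smul_eq_zero {P : Type*} [AddCommGroup P] [Module A P]
    [Module.Projective A P] {e u : A} (h : ∀ x : A, e * x = x → u * x = 0 → x = 0) {z : P}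
    (hez : e • z = z) (huz : u • z = 0) : z = 0 := by
  obtain ⟨s, hs⟩ := Module.projective_def'.1 (inferInstance : Module.Projective A P)
  have hsz : s z = 0 := by
    ext m
    refine h _ ?_ ?_
    · conv_rhs => rw [← hez, map_smul]
      rfl
    · have := DFunLike.congr_fun (congrArg s huz) m
      rw [map_smul, map_zero] at this
      exact this
  rw [← LinearMap.id_apply (R := A) z, ← hs, LinearMap.comp_apply, hsz, map_zero]

/-- A snake argument: f is a nonzero class in the cokernel of u on A that dies in `J.I 0`, so it
comes from an element of ker u in the first cosyzygy. That cosyzygy embeds into `J.I 1`, where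
projectivity rules out such elements. -/
theorem not_domDimGE_two {e u f : A} (he : e * e = e) (hue : u * e = u)
    (hproj : ∀ x : A, e * x = x → u * x = 0 → x = 0) (hext : ∀ x : A, x * u = 0 → x * f = 0)
    (hf : ∀ x : A, u * x ≠ f) : ¬ DomDimGE A A 2 := by
  rintro ⟨J, hJ⟩
  have hP := hJ 1 (by norm_num)
  obtain ⟨y, hy⟩ := Module.Injective.exists_smul_eq (J.injective 0) u (J.ι f) fun x hx => by
    rw [← map_smul, smul_eq_mul, hext x hx, map_zero]
  have h0 : J.d 0 (e • y) = 0 := by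
    refine Module.Projective.eq_zero_of_smul_eq_zero hproj ?_ ?_
    · rw [← map_smul, smul_smul, he]
    · rw [← map_smul, smul_smul, hue, hy]
      exact J.exact_zero.apply_apply_eq_zero f
  obtain ⟨x, hx⟩ := (J.exact_zero _).1 h0
  refine hf x (J.ι_injective ?_)
  rw [← smul_eq_mul, map_smul, hx, smul_smul, hue, hy]

theorem not_domDimGE_three {e g u q r : A} (he : e * e = e) (hg : g * g = g) (hue : u * e = u)
    (hqg : q * g = q) (hqu : q * u = 0)
    (hproj : ∀ x : A, e * x = x → u * x = 0 → x = 0) (hext : ∀ x : A, x * q = 0 → x * r = 0)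
    (hu : ∀ x : A, x * u = 0 → ∃ x', x * g = x' * q)
    (hr : ∀ x : A, q * x ≠ r) : ¬ DomDimGE A A 3 := by
  rintro ⟨J, hJ⟩
  have hP := hJ 2 (by norm_num)
  obtain ⟨y, hy⟩ := Module.Injective.exists_smul_eq (J.injective 0) q (J.ι r) fun x hx => by
    rw [← map_smul, smul_eq_mul, hext x hx, map_zero]
  have hqy : q • J.d 0 (g • y) = 0 := by
    rw [← map_smul, smul_smul, hqg, hy]
    exact J.exact_zero.apply_apply_eq_zero r
  -- By `hu`, whatever annihilates u acts on e_a-type elements, those fixed by g, through a multiple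
  -- of q, and q kills `J.d 0 (g • y)`.
  obtain ⟨w, hw⟩ := Module.Injective.exists_smul_eq (J.injective 1) u (J.d 0 (g • y))
    fun x hx => by
      obtain ⟨x', hx'⟩ := hu x hx
      have : x • J.d 0 (g • y) = (x * g) • J.d 0 (g • y) := by
        rw [mul_smul, ← map_smul _ g, smul_smul, hg]
      rw [this, hx', mul_smul, hqy, smul_zero]
  have h0 : J.d 1 (e • w) = 0 := by
    refine Module.Projective.eq_zero_of_smul_eq_zero hproj ?_ ?_
    · rw [← map_smul, smul_smul, he]
    · rw [← map_smul, smul_smul, hue, hw]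
      exact (J.exact_succ 0).apply_apply_eq_zero _
  obtain ⟨y', hy'⟩ := (J.exact_succ 0 _).1 h0
  have h1 : J.d 0 (g • y - u • y') = 0 := by
    rw [map_sub, map_smul _ u, hy', smul_smul, hue, hw, sub_self]
  obtain ⟨x, hx⟩ := (J.exact_zero _).1 h1
  refine hr x (J.ι_injective ?_)
  rw [← smul_eq_mul, map_smul, hx, smul_sub, smul_smul, smul_smul, hqg, hqu, zero_smul, sub_zero,
    hy]

end InjectiveEnvelopes

/-! ### Algebras with a multiplicative basis indexed by intervals -/

/-- Coordinates on an algebra with a basis `path i j`, where `(i, j)` runs through a set of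
intervals in `Fin n` that is closed under subintervals, such that
`path j k * path i j = path i k` (to be read as `0` if `(i, k)` is not in the set) and all other
products of basis elements vanish. -/
structure IntervalCoordinates (K : Type v) (A : Type u) [Field K] [Ring A] [Algebra K A]
    (n : ℕ) where
  /-- the set of intervals -/
  supp : Fin n → Fin n → Prop
  /-- the basis elements -/
  path : Fin n → Fin n → A
  /-- the coordinate functions -/
  coeff : Fin n → Fin n → A →ₗ[K] K
  le_of_supp : ∀ {i j}, supp i j → i ≤ j
  supp_refl : ∀ i, supp i i
  supp_mono : ∀ {i i' j' j}, supp i j → i ≤ i' → i' ≤ j' → j' ≤ j → supp i' j'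
  coeff_eq_zero : ∀ {i j}, ¬ supp i j → ∀ x, coeff i j x = 0
  ext : ∀ {x y}, (∀ i j, supp i j → coeff i j x = coeff i j y) → x = y
  coeff_mul : ∀ {i j}, supp i j → ∀ x y, coeff i j (x * y) = ∑ k, coeff k j x * coeff i k y
  coeff_path_self : ∀ {i j}, supp i j → coeff i j (path i j) = 1
  coeff_path_of_ne : ∀ {i j k l}, i ≠ k ∨ j ≠ l → coeff i j (path k l) = 0

namespace IntervalCoordinates

variable {K : Type v} {A : Type u} [Field K] [Ring A] [Algebra K A] {n : ℕ}
  (B : IntervalCoordinates K A n)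

theorem coeff_path_mul {i k l : Fin n} (h : B.supp i l) (hkl : k ≤ l) (x : A) :
    B.coeff i l (B.path k l * x) = B.coeff i k x := by
  rw [B.coeff_mul h, Finset.sum_eq_single k]
  · by_cases hik : B.supp i k
    · rw [B.coeff_path_self (B.supp_mono h (B.le_of_supp hik) hkl le_rfl), one_mul]
    · rw [B.coeff_eq_zero hik, mul_zero]
  · intro m _ hm
    rw [B.coeff_path_of_ne (Or.inl hm), zero_mul]
  · simp

theorem coeff_path_mul_of_ne {i j k l : Fin n} (hj : j ≠ l) (x : A) :
    B.coeff i j (B.path k l * x) = 0 := by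
  by_cases h : B.supp i j
  · rw [B.coeff_mul h]
    exact Finset.sum_eq_zero fun m _ => by rw [B.coeff_path_of_ne (Or.inr hj), zero_mul]
  · exact B.coeff_eq_zero h _

theorem coeff_mul_path {k l j : Fin n} (h : B.supp k j) (hkl : k ≤ l) (x : A) :
    B.coeff k j (x * B.path k l) = B.coeff l j x := by
  rw [B.coeff_mul h, Finset.sum_eq_single l]
  · by_cases hlj : B.supp l j
    · rw [B.coeff_path_self (B.supp_mono h le_rfl hkl (B.le_of_supp hlj)), mul_one]
    · rw [B.coeff_eq_zero hlj, zero_mul]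
  · intro m _ hm
    rw [B.coeff_path_of_ne (Or.inr hm), mul_zero]
  · simp

theorem coeff_mul_path_of_ne {i j k l : Fin n} (hi : i ≠ k) (x : A) :
    B.coeff i j (x * B.path k l) = 0 := by
  by_cases h : B.supp i j
  · rw [B.coeff_mul h]
    exact Finset.sum_eq_zero fun m _ => by rw [B.coeff_path_of_ne (Or.inl hi), mul_zero]
  · exact B.coeff_eq_zero h _

theorem path_mul_path {i j k : Fin n} (hij : i ≤ j) (hjk : j ≤ k) :
    B.path j k * B.path i j = B.path i k := by
  refine B.ext fun a b hab => ?_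
  by_cases hb : b = k
  · subst hb
    rw [B.coeff_path_mul hab hjk]
    by_cases ha : a = i
    · subst ha
      rw [B.coeff_path_self hab, B.coeff_path_self (B.supp_mono hab le_rfl hij hjk)]
    · rw [B.coeff_path_of_ne (Or.inl ha), B.coeff_path_of_ne (Or.inl ha)]
  · rw [B.coeff_path_mul_of_ne hb, B.coeff_path_of_ne (Or.inr hb)]

theorem path_eq_zero {i j : Fin n} (h : ¬ B.supp i j) : B.path i j = 0 := by
  refine B.ext fun a b hab => ?_
  rw [map_zero]
  refine B.coeff_path_of_ne ?_
  by_contra! hne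
  exact h (hne.1 ▸ hne.2 ▸ hab)

/-- If every interval ending in `a` extends to `b`, then left multiplication by `path a b` is
injective on the elements supported on intervals ending in `a`. -/
theorem eq_zero_of_path_mul_eq_zero {a b : Fin n} (hab : a ≤ b)
    (h : ∀ i, B.supp i a → B.supp i b) (x : A) (hx : B.path a a * x = x)
    (h0 : B.path a b * x = 0) : x = 0 := by
  refine B.ext fun i j hij => ?_
  rw [map_zero]
  by_cases hj : j = a
  · subst hj
    rw [← B.coeff_path_mul (h i hij) hab, h0, map_zero]
  · rw [← hx, B.coeff_path_mul_of_ne hj]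

theorem not_domDimGE_two {a b : Fin n} (hab : a < b) (hs : ∀ j, B.supp b j → B.supp a j)
    (ht : ∀ i, B.supp i a → B.supp i b) : ¬ DomDimGE A A 2 := by
  refine _root_.not_domDimGE_two (e := B.path a a) (u := B.path a b) (f := B.path b b)
    (B.path_mul_path le_rfl le_rfl) (B.path_mul_path le_rfl hab.le)
    (B.eq_zero_of_path_mul_eq_zero hab.le ht) (fun x hx => B.ext fun i j hij => ?_)
    (fun x hx => ?_)
  · rw [map_zero]
    by_cases hi : i = b
    · subst hi
      rw [B.coeff_mul_path hij le_rfl, ← B.coeff_mul_path (hs j hij) hab.le, hx, map_zero]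
    · exact B.coeff_mul_path_of_ne hi x
  -- A multiple of `path a b` has at (b, b) the coefficient of x at (b, a), which vanishes because a
  -- < b.
  · have h := congrArg (B.coeff b b) hx
    rw [B.coeff_path_mul (B.supp_refl b) hab.le, B.coeff_path_self (B.supp_refl b),
      B.coeff_eq_zero fun h => hab.not_ge (B.le_of_supp h)] at h
    exact zero_ne_one h

/-- By minimality of j₀, every path from a that dies after `path a' a` factors through `path a j₀`;
so `path a j₀` generates the annihilator of `path a' a` in the projective of a. -/
theorem not_domDimGE_three {a' a a₁ j₀ : Fin n} (ha' : a' < a) (ha : a < a₁) (hj : a₁ ≤ j₀)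
    (hs : ∀ j, B.supp a₁ j → B.supp a j) (ht : ∀ i, B.supp i a' → B.supp i a)
    (h₀ : B.supp a₁ j₀) (h₀' : ¬ B.supp a' j₀)
    (hmin : ∀ j, B.supp a j → ¬ B.supp a' j → j₀ ≤ j) : ¬ DomDimGE A A 3 := by
  have haj : a ≤ j₀ := ha.le.trans hj
  refine _root_.not_domDimGE_three (e := B.path a' a') (g := B.path a a) (u := B.path a' a)
    (q := B.path a j₀) (r := B.path a₁ j₀) (B.path_mul_path le_rfl le_rfl)
    (B.path_mul_path le_rfl le_rfl) (B.path_mul_path le_rfl ha'.le) (B.path_mul_path le_rfl haj)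
    ((B.path_mul_path ha'.le haj).trans (B.path_eq_zero h₀'))
    (B.eq_zero_of_path_mul_eq_zero ha'.le ht) (fun x hx => B.ext fun i j hij => ?_)
    -- The witness replaces each path from a to j occurring in x by its remainder after j₀.
    (fun x hx => ⟨∑ j, B.coeff a j x • B.path j₀ j, B.ext fun i j hij => ?_⟩) (fun x hx => ?_)
  · rw [map_zero]
    by_cases hi : i = a₁
    · subst hi
      rw [B.coeff_mul_path hij hj, ← B.coeff_mul_path (hs j hij) haj, hx, map_zero]
    · exact B.coeff_mul_path_of_ne hi x
  · by_cases hi : i = a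
    · subst hi
      rw [B.coeff_mul_path hij le_rfl, B.coeff_mul_path hij haj, map_sum,
        Finset.sum_eq_single j]
      · rw [map_smul, smul_eq_mul]
        by_cases hj' : B.supp a' j
        · rw [← B.coeff_mul_path hj' ha'.le, hx, map_zero, zero_mul]
        · rw [B.coeff_path_self (B.supp_mono hij haj (hmin j hij hj') le_rfl), mul_one]
      · intro k _ hk
        rw [map_smul, B.coeff_path_of_ne (Or.inr hk.symm), smul_zero]
      · simp
    · rw [B.coeff_mul_path_of_ne hi, B.coeff_mul_path_of_ne hi]
  · have h := congrArg (B.coeff a₁ j₀) hx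
    rw [B.coeff_path_mul h₀ haj, B.coeff_path_self h₀,
      B.coeff_eq_zero fun h => ha.not_ge (B.le_of_supp h)] at h
    exact zero_ne_one h

/-- The indecomposable projective module of the vertex `c`. -/
abbrev proj (c : Fin n) : Ideal A := Ideal.span {B.path c c}

theorem mul_path_self_of_mem_proj {c : Fin n} {x : A} (hx : x ∈ B.proj c) :
    x * B.path c c = x := by
  obtain ⟨y, rfl⟩ := Ideal.mem_span_singleton'.1 hx
  rw [mul_assoc, B.path_mul_path le_rfl le_rfl]

theorem mem_proj_of_mul_path_self {c : Fin n} {x : A} (hx : x * B.path c c = x) :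
    x ∈ B.proj c := Ideal.mem_span_singleton'.2 ⟨x, hx⟩

theorem projective_proj (c : Fin n) : Module.Projective A (B.proj c) :=
  Module.Projective.of_split (B.proj c).subtype
    ((LinearMap.toSpanSingleton A A (B.path c c)).codRestrict (B.proj c) fun x =>
      Ideal.mem_span_singleton'.2 ⟨x, rfl⟩)
    (LinearMap.ext fun x => Subtype.ext (B.mul_path_self_of_mem_proj x.2))

/-- If `(c, b)` is a maximal interval in the support, then the projective module of the vertex `c`
is injective. -/
theorem injective_proj {c b : Fin n} (hcb : B.supp c b) (hb : ∀ j, B.supp c j → j ≤ b)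
    (hc : ∀ i, B.supp i b → c ≤ i) : Module.Injective A (B.proj c) := by
  refine Module.Baer.injective fun I g => ?_
  -- The projective of c is the K-dual of e_b A, so g is determined by its coefficient at (c, b).
  -- Baer's criterion thus reduces to extending a linear functional.
  let φ : I.restrictScalars K →ₗ[K] K :=
    B.coeff c b ∘ₗ ((B.proj c).subtype.restrictScalars K) ∘ₗ (g.restrictScalars K)
  obtain ⟨f, hf⟩ := LinearMap.exists_extend φ
  have hfg : ∀ (x : A) (hx : x ∈ I), f x = B.coeff c b (g ⟨x, hx⟩ : A) := fun x hx =>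
    LinearMap.congr_fun hf ⟨x, hx⟩
  -- The element of the projective of c that corresponds to the restriction of f to e_b A.
  let w : A := ∑ d, f (B.path d b) • B.path c d
  have hw : w ∈ B.proj c := B.mem_proj_of_mul_path_self (by
    rw [Finset.sum_mul]
    refine Finset.sum_congr rfl fun d _ => ?_
    by_cases hd : B.supp c d
    · rw [smul_mul_assoc, B.path_mul_path le_rfl (B.le_of_supp hd)]
    · rw [B.path_eq_zero hd, smul_zero, zero_mul])
  have hwd : ∀ d, B.supp c d → B.coeff c d w = f (B.path d b) := by
    intro d hd
    rw [map_sum, Finset.sum_eq_single d]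
    · rw [map_smul, B.coeff_path_self hd, smul_eq_mul, mul_one]
    · intro k _ hk
      rw [map_smul, B.coeff_path_of_ne (Or.inr hk.symm), smul_zero]
    · simp
  refine ⟨LinearMap.toSpanSingleton A (B.proj c) ⟨w, hw⟩, fun x hx => Subtype.ext ?_⟩
  change x * w = g ⟨x, hx⟩
  refine B.ext fun i j hij => ?_
  by_cases hi : i = c
  swap
  · rw [← B.mul_path_self_of_mem_proj (g ⟨x, hx⟩).2, B.coeff_mul_path_of_ne hi,
      ← B.mul_path_self_of_mem_proj hw, ← mul_assoc, B.coeff_mul_path_of_ne hi]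
  subst hi
  have hjb := hb j hij
  have hjx : B.path j b * x ∈ I := I.mul_mem_left _ hx
  have hpx : B.path j b * x = ∑ d, B.coeff d j x • B.path d b := by
    refine B.ext fun k l hkl => ?_
    rw [map_sum]
    by_cases hl : l = b
    · subst hl
      rw [B.coeff_path_mul hkl hjb, Finset.sum_eq_single k]
      · rw [map_smul, B.coeff_path_self hkl, smul_eq_mul, mul_one]
      · intro d _ hd
        rw [map_smul, B.coeff_path_of_ne (Or.inl hd.symm), smul_zero]
      · simp
    · rw [B.coeff_path_mul_of_ne hl]
      refine (Finset.sum_eq_zero fun d _ => ?_).symm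
      rw [map_smul, B.coeff_path_of_ne (Or.inr hl), smul_zero]
  have hgx : (g ⟨B.path j b * x, hjx⟩ : A) = B.path j b * (g ⟨x, hx⟩ : A) :=
    congrArg Subtype.val (map_smul g (B.path j b) ⟨x, hx⟩)
  rw [← B.coeff_path_mul hcb hjb (g ⟨x, hx⟩ : A), ← hgx, ← hfg, hpx, map_sum, B.coeff_mul hij]
  refine Finset.sum_congr rfl fun d _ => ?_
  rw [map_smul, smul_eq_mul]
  by_cases hd : B.supp i d
  · rw [hwd d hd]
  · rw [B.coeff_eq_zero hd, mul_zero]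
    by_cases hdb : B.supp d b
    · exact (hd (B.supp_mono hcb le_rfl (hc d hdb) (B.le_of_supp hdb))).elim
    · rw [B.path_eq_zero hdb, map_zero, mul_zero]

/-- Extend the interval at a to the right as far as possible, up to b, and then to the left as far
as possible, down to c; the result is a maximal interval. -/
theorem exists_injective_proj (a : Fin n) :
    ∃ c, c ≤ a ∧ Module.Injective A (B.proj c) ∧ ∀ j, B.supp a j → B.supp c j := by
  classical
  obtain ⟨b, hab, hb⟩ := (Finset.univ.filter (B.supp a)).exists_max_image id
    ⟨a, by simpa using B.supp_refl a⟩
  simp only [Finset.mem_filter, Finset.mem_univ, true_and, id] at hab hb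
  obtain ⟨c, hcb, hc⟩ := (Finset.univ.filter fun c => B.supp c b).exists_min_image id
    ⟨b, by simpa using B.supp_refl b⟩
  simp only [Finset.mem_filter, Finset.mem_univ, true_and, id] at hcb hc
  have hca : c ≤ a := hc a hab
  refine ⟨c, hca, B.injective_proj hcb (fun j hj => ?_) hc, fun j hj =>
    B.supp_mono hcb le_rfl (hca.trans (B.le_of_supp hj)) (hb j hj)⟩
  by_contra hlt
  rw [not_le] at hlt
  exact hlt.not_ge (hb j (B.supp_mono hj hca ((B.le_of_supp hab).trans hlt.le) le_rfl))

/-- Right multiplication by `path (c a) a` preserves the coefficients of the paths starting at a.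
Taken over all a, these maps embed A into a finite product of projective-injective modules. -/
theorem domDimGE_one (B : IntervalCoordinates K A n) : DomDimGE A A 1 := by
  choose c hca hinj hc using B.exists_injective_proj
  have hproj := B.projective_proj
  have : Module.Projective A (∀ a, B.proj (c a)) :=
    Module.Projective.of_equiv (DFinsupp.linearEquivFunOnFintype (R := A))
  let f : A →ₗ[A] ∀ a, B.proj (c a) := LinearMap.pi fun a =>
    (LinearMap.toSpanSingleton A A (B.path (c a) a)).codRestrict (B.proj (c a)) fun x =>
      B.mem_proj_of_mul_path_self (by
        rw [LinearMap.toSpanSingleton_apply, smul_eq_mul, mul_assoc,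
          B.path_mul_path le_rfl (hca a)])
  refine domDimGE_one_of_injective f ((injective_iff_map_eq_zero f).2 fun x hx => ?_)
  have h : ∀ a, x * B.path (c a) a = 0 := fun a =>
    congrArg Subtype.val (congrFun hx a)
  refine B.ext fun a j haj => ?_
  rw [← B.coeff_mul_path (hc a j haj) (hca a), h, map_zero, map_zero]

end IntervalCoordinates

/-! ### Coordinates on the bound quiver algebras of the linear quiver -/

namespace PathAlgebra

variable (K : Type u) {V : Type v} [Field K] [Quiver.{w} V]

open Classical in
/-- The sum of the coefficients of the paths from `a` to `b`. -/
noncomputable def coeffSum (a b : V) : PathAlgebra K V →ₗ[K] K :=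
  lift K fun p => if p.source = a ∧ p.target = b then 1 else 0

open Classical in
theorem coeffSum_ofPath (a b : V) (p : QuiverPath V) :
    coeffSum K a b (ofPath K p) = if p.source = a ∧ p.target = b then 1 else 0 :=
  lift_ofPath K _ p

/-- The matrix with entry `coeffSum K a b x` in row b and column a is multiplicative in x: a
composite of two paths contributes only at the vertex where they meet. -/
theorem coeffSum_mul [Fintype V] (a b : V) (x y : PathAlgebra K V) :
    coeffSum K a b (x * y) = ∑ k, coeffSum K k b x * coeffSum K a k y := by
  classical
  induction x using induction_on with
  | zero => simp
  | add x x' hx hx' => simp only [add_mul, map_add, hx, hx', Finset.sum_add_distrib]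
  | smul c p =>
    induction y using induction_on with
    | zero => simp
    | add y y' hy hy' => simp only [mul_add, map_add, hy, hy', Finset.sum_add_distrib]
    | smul d q =>
      have key : coeffSum K a b (ofPath K p * ofPath K q) =
          ∑ k, coeffSum K k b (ofPath K p) * coeffSum K a k (ofPath K q) := by
        rw [ofPath_mul_ofPath, Finset.sum_eq_single p.source]
        · by_cases h : q.target = p.source
          · rw [pathMul, dif_pos h]
            simp only [coeffSum_ofPath, QuiverPath.after, h, true_and, and_true, ite_mul, one_mul,
              zero_mul, ite_and]
            split_ifs <;> rfl
          · rw [pathMul, dif_neg h]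
            simp [coeffSum_ofPath, h]
        · intro k _ hk
          simp [coeffSum_ofPath, hk.symm]
        · simp
      simp only [smul_mul_assoc, mul_smul_comm, map_smul, key, smul_eq_mul, Finset.mul_sum]
      exact Finset.sum_congr rfl fun k _ => by ring

end PathAlgebra

/-! ### Paths of the linear quiver -/

namespace LinearQuiver

variable {n : ℕ}

theorem pos_add_length {a b : LinearQuiver n} (p : Quiver.Path a b) :
    pos a + p.length = pos b := by
  induction p with
  | nil => rfl
  | cons p e ih =>
    have := e.down
    rw [Quiver.Path.length_cons]
    omega

theorem eq_of_pos_eq {a b : LinearQuiver n} (h : pos a = pos b) : a = b := Fin.ext h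

theorem subsingleton_path {a b : LinearQuiver n} (p q : Quiver.Path a b) : p = q := by
  induction p with
  | nil => exact (Quiver.Path.eq_nil_of_length_zero q (by have := pos_add_length q; omega)).symm
  | @cons b c p e ih =>
    cases q with
    | nil =>
      have := pos_add_length p
      have := e.down
      omega
    | @cons b' _ q f =>
      obtain rfl : b = b' := eq_of_pos_eq (by have := e.down; have := f.down; omega)
      rw [ih q, show e = f from congrArg PLift.up (Subsingleton.elim e.down f.down)]

theorem quiverPath_ext {p q : QuiverPath (LinearQuiver n)} (hs : p.source = q.source)
    (ht : p.target = q.target) : p = q := by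
  obtain ⟨a, b, p⟩ := p
  obtain ⟨c, d, q⟩ := q
  dsimp only at hs ht
  subst hs ht
  rw [subsingleton_path p q]

theorem nonempty_path {a b : LinearQuiver n} (h : pos a ≤ pos b) : Nonempty (Quiver.Path a b) := by
  obtain ⟨k, hk⟩ := Nat.exists_eq_add_of_le h
  induction k generalizing b with
  | zero =>
    obtain rfl : b = a := eq_of_pos_eq hk
    exact ⟨Quiver.Path.nil⟩
  | succ k ih =>
    have hb : pos b < n := b.2
    let c : LinearQuiver n := ⟨pos a + k, by omega⟩
    obtain ⟨p⟩ := ih (b := c) (Nat.le_add_right _ _) rfl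
    exact ⟨p.cons ⟨hk.symm⟩⟩

variable (K : Type u) [Field K]

open Classical in
/-- The path from `a` to `b` as an element of the path algebra; zero if there is none. -/
noncomputable def pathElt (a b : LinearQuiver n) : PathAlgebra K (LinearQuiver n) :=
  if h : pos a ≤ pos b then PathAlgebra.ofPath K ⟨a, b, (nonempty_path h).some⟩ else 0

theorem ofPath_eq_pathElt (p : QuiverPath (LinearQuiver n)) :
    PathAlgebra.ofPath K p = pathElt K p.source p.target := by
  have h := pos_add_length p.path
  rw [pathElt, dif_pos (by omega)]
  exact congrArg _ (quiverPath_ext rfl rfl)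

theorem coeffSum_pathElt_self {a b : LinearQuiver n} (h : pos a ≤ pos b) :
    PathAlgebra.coeffSum K a b (pathElt K a b) = 1 := by
  rw [pathElt, dif_pos h, PathAlgebra.coeffSum_ofPath]
  simp

theorem coeffSum_pathElt_of_ne {a b c d : LinearQuiver n} (h : a ≠ c ∨ b ≠ d) :
    PathAlgebra.coeffSum K a b (pathElt K c d) = 0 := by
  rw [pathElt]
  split_ifs
  · rw [PathAlgebra.coeffSum_ofPath, if_neg]
    rintro ⟨h1, h2⟩
    exact h.elim (fun h => h h1.symm) fun h => h h2.symm
  · exact map_zero _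

theorem pathElt_mul_pathElt {a b c : LinearQuiver n} (hab : pos a ≤ pos b) (hbc : pos b ≤ pos c) :
    pathElt K b c * pathElt K a b = pathElt K a c := by
  rw [pathElt, pathElt, dif_pos hab, dif_pos hbc, PathAlgebra.ofPath_mul_ofPath,
    PathAlgebra.pathMul, dif_pos rfl, ofPath_eq_pathElt]
  rfl

theorem eq_sum_coeffSum_smul (x : PathAlgebra K (LinearQuiver n)) :
    x = ∑ a, ∑ b, PathAlgebra.coeffSum K a b x • pathElt K a b := by
  induction x using PathAlgebra.induction_on with
  | zero => simp
  | add x y hx hy =>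
    simp only [map_add, add_smul, Finset.sum_add_distrib]
    rw [← hx, ← hy]
  | smul c p =>
    rw [Finset.sum_eq_single p.source, Finset.sum_eq_single p.target]
    · rw [map_smul, PathAlgebra.coeffSum_ofPath, if_pos ⟨rfl, rfl⟩, smul_eq_mul, mul_one,
        ofPath_eq_pathElt]
    · intro b _ hb
      rw [map_smul, PathAlgebra.coeffSum_ofPath, if_neg fun h => hb h.2.symm, smul_zero, zero_smul]
    · simp
    · intro a _ ha
      refine Finset.sum_eq_zero fun b _ => ?_
      rw [map_smul, PathAlgebra.coeffSum_ofPath, if_neg fun h => ha h.1.symm, smul_zero, zero_smul]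
    · simp

/-- The path from `a` to `b` exists and contains no relation. -/
def IsNonzeroInterval (R : Set (QuiverPath (LinearQuiver n))) (a b : LinearQuiver n) : Prop :=
  pos a ≤ pos b ∧ ∀ r ∈ R, pos a ≤ pos r.source → ¬ pos r.target ≤ pos b

/-! ### The relation ideal in coordinates -/

variable {R : Set (QuiverPath (LinearQuiver n))}

theorem IsNonzeroInterval.mono {a b c d : LinearQuiver n} (h : IsNonzeroInterval R a d)
    (hab : pos a ≤ pos b) (hbc : pos b ≤ pos c) (hcd : pos c ≤ pos d) :
    IsNonzeroInterval R b c :=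
  ⟨hbc, fun r hr h1 h2 => h.2 r hr (hab.trans h1) (h2.trans hcd)⟩

theorem coeffSum_eq_zero_of_lt {a b : LinearQuiver n} (h : ¬ pos a ≤ pos b)
    (x : PathAlgebra K (LinearQuiver n)) : PathAlgebra.coeffSum K a b x = 0 := by
  induction x using PathAlgebra.induction_on with
  | zero => exact map_zero _
  | add x y hx hy => rw [map_add, hx, hy, add_zero]
  | smul c p =>
    rw [map_smul, PathAlgebra.coeffSum_ofPath, if_neg, smul_zero]
    rintro ⟨rfl, rfl⟩
    have := pos_add_length p.path
    omega

/-- The elements whose coefficients vanish at all nonzero intervals form a two-sided ideal, because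
subintervals of nonzero intervals are nonzero. This ideal contains the relations. -/
theorem coeffSum_eq_zero_of_mem {a b : LinearQuiver n} (h : IsNonzeroInterval R a b)
    {x : PathAlgebra K (LinearQuiver n)} (hx : x ∈ relationIdeal K R) :
    PathAlgebra.coeffSum K a b x = 0 := by
  have hmul : ∀ {a b : LinearQuiver n} (x y : PathAlgebra K (LinearQuiver n)),
      (∀ k, pos a ≤ pos k → pos k ≤ pos b →
        PathAlgebra.coeffSum K k b x * PathAlgebra.coeffSum K a k y = 0) →
      PathAlgebra.coeffSum K a b (x * y) = 0 := by
    intro a b x y hxy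
    rw [PathAlgebra.coeffSum_mul]
    refine Finset.sum_eq_zero fun k _ => ?_
    by_cases h1 : pos a ≤ pos k
    · by_cases h2 : pos k ≤ pos b
      · exact hxy k h1 h2
      · rw [coeffSum_eq_zero_of_lt K h2, zero_mul]
    · rw [coeffSum_eq_zero_of_lt K h1, mul_zero]
  let T : TwoSidedIdeal (PathAlgebra K (LinearQuiver n)) := TwoSidedIdeal.mk'
    {x | ∀ a b, IsNonzeroInterval R a b → PathAlgebra.coeffSum K a b x = 0}
    (fun a b _ => map_zero _)
    (fun hx hy a b hab => by rw [map_add, hx a b hab, hy a b hab, add_zero])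
    (fun hx a b hab => by rw [map_neg, hx a b hab, neg_zero])
    (fun hy a b hab => hmul _ _ fun k h1 h2 => by
      rw [hy a k (hab.mono le_rfl h1 h2), mul_zero])
    (fun hx a b hab => hmul _ _ fun k h1 h2 => by
      rw [hx k b (hab.mono h1 h2 le_rfl), zero_mul])
  have hT : x ∈ T := by
    refine TwoSidedIdeal.mem_span_iff.1 hx T ?_
    rintro _ ⟨r, hr, rfl⟩
    refine (TwoSidedIdeal.mem_mk' _ _ _ _ _ _ _).2 fun a b hab => ?_
    rw [PathAlgebra.coeffSum_ofPath, if_neg]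
    rintro ⟨rfl, rfl⟩
    exact hab.2 r hr le_rfl le_rfl
  exact (TwoSidedIdeal.mem_mk' _ _ _ _ _ _ _).1 hT a b h

/-- Such a path, if it exists, factors through a relation. -/
theorem pathElt_mem_relationIdeal {a b : LinearQuiver n} (h : ¬ IsNonzeroInterval R a b) :
    pathElt K a b ∈ relationIdeal K R := by
  by_cases hab : pos a ≤ pos b
  · have : ∃ r ∈ R, pos a ≤ pos r.source ∧ pos r.target ≤ pos b := by
      by_contra! hr
      exact h ⟨hab, fun r hrR h1 => (hr r hrR h1).not_ge⟩
    obtain ⟨r, hr, h1, h2⟩ := this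
    have hst := pos_add_length r.path
    have hrI : PathAlgebra.ofPath K r ∈ relationIdeal K R :=
      TwoSidedIdeal.subset_span ⟨r, hr, rfl⟩
    rw [ofPath_eq_pathElt] at hrI
    rw [← pathElt_mul_pathElt K (h1.trans (by omega)) h2,
      ← pathElt_mul_pathElt K h1 (by omega : pos r.source ≤ pos r.target)]
    exact TwoSidedIdeal.mul_mem_left _ _ _ (TwoSidedIdeal.mul_mem_right _ _ _ hrI)
  · rw [pathElt, dif_neg hab]
    exact TwoSidedIdeal.zero_mem _

/-! ### Coordinates on the quotient algebra -/

variable (R)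

/-- The coordinate of an element of the bound quiver algebra at a nonzero path. -/
noncomputable def quotientCoeff (a b : LinearQuiver n) (h : IsNonzeroInterval R a b) :
    BoundQuiverAlgebra K R →ₗ[K] K where
  toFun q := Quotient.liftOn' q (PathAlgebra.coeffSum K a b) fun x y hxy => by
    rw [← sub_eq_zero, ← map_sub]
    exact coeffSum_eq_zero_of_mem K h (((relationIdeal K R).rel_iff x y).1 hxy)
  map_add' x y := by
    induction x using Quotient.inductionOn'
    induction y using Quotient.inductionOn'
    exact map_add (PathAlgebra.coeffSum K a b) _ _
  map_smul' c x := by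
    induction x using Quotient.inductionOn'
    exact map_smul (PathAlgebra.coeffSum K a b) _ _

theorem quotientCoeff_mk {a b : LinearQuiver n} (h : IsNonzeroInterval R a b)
    (x : PathAlgebra K (LinearQuiver n)) :
    quotientCoeff K R a b h ((relationIdeal K R).ringCon.mk' x) = PathAlgebra.coeffSum K a b x :=
  rfl

open Classical in
/-- The coordinate of an element of the bound quiver algebra at a path; zero if the path is zero. -/
noncomputable def pathCoeff (a b : LinearQuiver n) : BoundQuiverAlgebra K R →ₗ[K] K :=
  if h : IsNonzeroInterval R a b then quotientCoeff K R a b h else 0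

variable {R}

theorem pathCoeff_mk {a b : LinearQuiver n} (h : IsNonzeroInterval R a b)
    (x : PathAlgebra K (LinearQuiver n)) :
    pathCoeff K R a b ((relationIdeal K R).ringCon.mk' x) = PathAlgebra.coeffSum K a b x := by
  rw [pathCoeff, dif_pos h, quotientCoeff_mk]

theorem pathCoeff_eq_zero {a b : LinearQuiver n} (h : ¬ IsNonzeroInterval R a b)
    (x : BoundQuiverAlgebra K R) : pathCoeff K R a b x = 0 := by
  rw [pathCoeff, dif_neg h, LinearMap.zero_apply]

theorem pathCoeff_mul {a b : LinearQuiver n} (h : IsNonzeroInterval R a b)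
    (x y : BoundQuiverAlgebra K R) :
    pathCoeff K R a b (x * y) = ∑ k, pathCoeff K R k b x * pathCoeff K R a k y := by
  obtain ⟨x, rfl⟩ := RingCon.mk'_surjective _ x
  obtain ⟨y, rfl⟩ := RingCon.mk'_surjective _ y
  rw [← map_mul, pathCoeff_mk K h, PathAlgebra.coeffSum_mul]
  refine Finset.sum_congr rfl fun k _ => ?_
  by_cases h1 : pos a ≤ pos k
  · by_cases h2 : pos k ≤ pos b
    · rw [pathCoeff_mk K (h.mono h1 h2 le_rfl), pathCoeff_mk K (h.mono le_rfl h1 h2)]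
    · rw [coeffSum_eq_zero_of_lt K h2, pathCoeff_eq_zero K fun h => h2 h.1, zero_mul, zero_mul]
  · rw [coeffSum_eq_zero_of_lt K h1, pathCoeff_eq_zero K (a := a) fun h => h1 h.1, mul_zero,
      mul_zero]

theorem pathCoeff_ext {x y : BoundQuiverAlgebra K R}
    (h : ∀ a b, IsNonzeroInterval R a b → pathCoeff K R a b x = pathCoeff K R a b y) : x = y := by
  obtain ⟨x, rfl⟩ := RingCon.mk'_surjective _ x
  obtain ⟨y, rfl⟩ := RingCon.mk'_surjective _ y
  refine (RingCon.eq _).2 (((relationIdeal K R).rel_iff x y).2 ?_)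
  rw [eq_sum_coeffSum_smul K (x - y)]
  refine sum_mem fun a _ => sum_mem fun b _ => ?_
  by_cases hab : IsNonzeroInterval R a b
  · have hxy := h a b hab
    rw [pathCoeff_mk K hab, pathCoeff_mk K hab] at hxy
    rw [map_sub, hxy, sub_self, zero_smul]
    exact TwoSidedIdeal.zero_mem _
  -- A two-sided ideal absorbs ring elements, so the scalar is first turned into a ring factor.
  · rw [← one_mul (pathElt K a b), ← smul_mul_assoc]
    exact TwoSidedIdeal.mul_mem_left _ _ _ (pathElt_mem_relationIdeal K hab)

/-! ### From relations to intervals, and the two bounds -/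

theorem pos_source_add_two_le (hR : ∀ r ∈ R, IsZeroRelation r) {r : QuiverPath (LinearQuiver n)}
    (hr : r ∈ R) : pos r.source + 2 ≤ pos r.target := by
  have h1 : 2 ≤ r.path.length := hR r hr
  have h2 := pos_add_length r.path
  omega

/-- The coordinates on a bound quiver algebra of the linear quiver. -/
noncomputable def intervalCoordinates (hR : ∀ r ∈ R, IsZeroRelation r) :
    IntervalCoordinates K (BoundQuiverAlgebra K R) n where
  supp i j := IsNonzeroInterval R i j
  path i j := (relationIdeal K R).ringCon.mk' (pathElt K i j)
  coeff i j := pathCoeff K R i j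
  le_of_supp h := h.1
  supp_refl i := ⟨le_rfl, fun r hr h1 h2 => by
    have := pos_source_add_two_le hR hr
    omega⟩
  supp_mono h h1 h2 h3 := h.mono h1 h2 h3
  coeff_eq_zero h x := pathCoeff_eq_zero K h x
  ext h := pathCoeff_ext K h
  coeff_mul h x y := pathCoeff_mul K h x y
  coeff_path_self h := (pathCoeff_mk K h _).trans (coeffSum_pathElt_self K h.1)
  coeff_path_of_ne {i j k l} hne := by
    by_cases h : IsNonzeroInterval R i j
    · exact (pathCoeff_mk K h _).trans (coeffSum_pathElt_of_ne K hne)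
    · exact pathCoeff_eq_zero K h _

/-- A relation inside [a, j] either starts at a or already lies inside [b, j]. -/
theorem IsNonzeroInterval.of_source {a b j : LinearQuiver n} (hab : pos a + 1 = pos b)
    (ha : a ∉ relationSources R) (h : IsNonzeroInterval R b j) : IsNonzeroInterval R a j := by
  refine ⟨by have := h.1; omega, fun r hr h1 => h.2 r hr ?_⟩
  have : pos a ≠ pos r.source := fun h => ha ⟨r, hr, (eq_of_pos_eq h).symm⟩
  omega

theorem IsNonzeroInterval.of_target {a b i : LinearQuiver n} (hab : pos a + 1 = pos b)
    (hb : b ∉ relationTargets R) (h : IsNonzeroInterval R i a) : IsNonzeroInterval R i b := by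
  refine ⟨by have := h.1; omega, fun r hr h1 h2 => h.2 r hr h1 ?_⟩
  have : pos b ≠ pos r.target := fun h => hb ⟨r, hr, (eq_of_pos_eq h).symm⟩
  omega

theorem lt_of_pos_succ {a b : LinearQuiver n} (hab : pos a + 1 = pos b) :
    @LT.lt (Fin n) _ a b :=
  Fin.lt_def.2 (Nat.lt_of_succ_le hab.le)

theorem domDim_eq_one_of_source_of_target (hR : ∀ r ∈ R, IsZeroRelation r) {a b : LinearQuiver n}
    (hab : pos a + 1 = pos b) (ha : a ∉ relationSources R) (hb : b ∉ relationTargets R) :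
    domDim (BoundQuiverAlgebra K R) = 1 := by
  have h1 := (intervalCoordinates K hR).domDimGE_one
  have h2 := (intervalCoordinates K hR).not_domDimGE_two (a := a) (b := b)
    (lt_of_pos_succ hab) (fun j hj => hj.of_source hab ha)
    (fun i hi => hi.of_target hab hb)
  exact le_antisymm (moduleDomDim_le_of_not h2) (le_iSup₂_of_le 1 h1 le_rfl)

theorem domDim_le_two_of_isFreeVertex (hR : ∀ r ∈ R, IsZeroRelation r) (hn : 2 ≤ n)
    {a : LinearQuiver n} (ha : IsFreeVertex R a) : domDim (BoundQuiverAlgebra K R) ≤ 2 := by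
  have han : pos a < n := a.2
  by_cases ha0 : pos a = 0
  · let b : LinearQuiver n := ⟨1, hn⟩
    have hb : pos b = 1 := rfl
    refine (domDim_eq_one_of_source_of_target K hR (b := b) (by omega) ha.1 ?_).le.trans
      (by norm_num)
    -- A relation has at least two arrows, so its target cannot be the second vertex.
    rintro ⟨r, hr, hrb⟩
    have := pos_source_add_two_le hR hr
    have : pos r.target = pos b := congrArg pos hrb
    omega
  let a' : LinearQuiver n := ⟨pos a - 1, by omega⟩
  have ha' : pos a' + 1 = pos a := Nat.sub_add_cancel (Nat.pos_of_ne_zero ha0)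
  have hlt := lt_of_pos_succ ha'
  have ht : ∀ i, IsNonzeroInterval R i a' → IsNonzeroInterval R i a := fun i hi =>
    hi.of_target ha' ha.2
  by_cases hs : ∀ j, IsNonzeroInterval R a j → IsNonzeroInterval R a' j
  · exact moduleDomDim_le_of_not fun h =>
      (intervalCoordinates K hR).not_domDimGE_two (a := a') (b := a) hlt hs ht (h.mono (by norm_num))
  classical
  push Not at hs
  obtain ⟨j₀, hj₀, hmin⟩ := (Finset.univ.filter fun j : LinearQuiver n =>
    IsNonzeroInterval R a j ∧ ¬ IsNonzeroInterval R a' j).exists_min_image pos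
    (by simpa [Finset.Nonempty] using hs)
  simp only [Finset.mem_filter, Finset.mem_univ, true_and] at hj₀ hmin
  -- The arrow from a' to a is nonzero since a is no target, so j₀ lies strictly beyond a and the
  -- vertex a₁ exists.
  have hne : pos a ≠ pos j₀ := fun h => by
    obtain rfl := eq_of_pos_eq h
    exact hj₀.2 (ht a' ((intervalCoordinates K hR).supp_refl a'))
  have haj : pos a + 1 ≤ pos j₀ := lt_of_le_of_ne hj₀.1.1 hne
  have hjn : pos j₀ < n := j₀.2
  let a₁ : LinearQuiver n := ⟨pos a + 1, by omega⟩
  have ha₁ : pos a + 1 = pos a₁ := rfl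
  exact moduleDomDim_le_of_not ((intervalCoordinates K hR).not_domDimGE_three (a' := a') (a := a)
    (a₁ := a₁) (j₀ := j₀) hlt (lt_of_pos_succ ha₁) haj
    (fun j hj => hj.of_source ha₁ ha.1) ht (hj₀.1.mono (by omega) haj le_rfl) hj₀.2
    fun j h1 h2 => hmin j ⟨h1, h2⟩)

end LinearQuiver

theorem mainTheorem7 {K : Type u} [Field K] (n : ℕ) (hn : 3 ≤ n)
    (R : Set (QuiverPath (LinearQuiver n))) (hR : ∀ r ∈ R, IsZeroRelation r) :
    ((∃ a b : LinearQuiver n, Nonempty (a ⟶ b) ∧ a ∉ relationSources R ∧ b ∉ relationTargets R) →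
      domDim (BoundQuiverAlgebra K R) = 1) ∧
    ((∃ a : LinearQuiver n, IsFreeVertex R a) → domDim (BoundQuiverAlgebra K R) ≤ 2) := by
  refine ⟨?_, ?_⟩
  · rintro ⟨a, b, ⟨e⟩, ha, hb⟩
    exact LinearQuiver.domDim_eq_one_of_source_of_target K hR e.down ha hb
  · rintro ⟨a, ha⟩
    exact LinearQuiver.domDim_le_two_of_isFreeVertex K hR (by omega) ha
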